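/- \textbf{Theorem.} Every Demuth random sequence computes a $1$-generic sequence. That is, for every Demuth random $X \in 2^\omega$ there is a $1$-generic $Y \in 2^\omega$ with $Y \le_T X$. Here $2^\omega$ is the space of infinite binary sequences with the product topology and the uniform measure $\mu$, determined by $\mu([\sigma]) = 2^{-|\sigma|}$ for every finite binary string $\sigma$, where $[\sigma]$ is the set of all $X \in 2^\omega$ having $\sigma$ as a prefix. A set $\mathcal{U} \subseteq 2^\omega$ is \emph{effectively open} if $\mathcal{U} = \bigcup_{\sigma \in S} [\sigma]$ for some computably enumerable set $S$ of strings. Let $(\mathcal{W}_e)_{e \in \omega}$ be the standard effective enumeration of all effectively open sets, where $\mathcal{W}_e$ is generated by the $e$-th c.e. set of strings. A function $g : \omega \to \omega$ is \emph{$\omega$-c.a.} if there are computable functions $a : \omega^2 \to \omega$ and $h : \omega \to \omega$ such that for all $n$ we have $\lim_s a(n,s) = g(n)$ and there are at most $h(n)$ many $s$ with $a(n,s) \neq a(n,s+1)$. A \emph{Demuth test} is a sequence $(\mathcal{W}_{g(n)})_{n \in \omega}$ where $g$ is $\omega$-c.a. and $\mu(\mathcal{W}_{g(n)}) \le 2^{-n}$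 for all $n$. A sequence $X$ is \emph{Demuth random} if for every Demuth test $(\mathcal{W}_{g(n)})_{n \in \omega}$ there are only finitely many $n$ with $X \in \mathcal{W}_{g(n)}$. A sequence $Y$ is \emph{$1$-generic} if for every effectively open set $\mathcal{U}$, $Y$ belongs to $\mathcal{U}$ or to the complement of the closure of $\mathcal{U}$. -/

import Mathlib

namespace DemuthGeneric

/-- The space `2^ω` of infinite binary sequences; it carries the product topology and the product
`σ`-algebra of the discrete space `Bool`. -/
abbrev Cantor : Type := ℕ → Bool

/-- The cylinder `[σ]`: the sequences that have the finite string `σ` as a prefix. -/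
def strCylinder (σ : List Bool) : Set Cantor :=
  {X | ∀ (i : ℕ) (hi : i < σ.length), X i = σ[i]}

/-- The open set `⋃_{σ ∈ S} [σ]` generated by a set `S` of strings. -/
def openOf (S : Set (List Bool)) : Set Cantor :=
  ⋃ σ ∈ S, strCylinder σ

/-- `U` is effectively open: it is generated by a computably enumerable set of strings. -/
def EffectivelyOpen (U : Set Cantor) : Prop :=
  ∃ S : Set (List Bool), REPred (fun σ => σ ∈ S) ∧ U = openOf S

/-- The `e`-th computably enumerable set of strings: the domain of the `e`-th partial computable
function, strings being identified with their codes. -/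
def ceSet (e : ℕ) : Set (List Bool) :=
  {σ | ((Nat.Partrec.Code.eval (Denumerable.ofNat Nat.Partrec.Code e)) (Encodable.encode σ)).Dom}

/-- The standard effective enumeration of all effectively open sets. -/
def effOpen (e : ℕ) : Set Cantor :=
  openOf (ceSet e)

/-- The sets `effOpen e` are exactly the effectively open sets. -/
theorem effectivelyOpen_iff (U : Set Cantor) : EffectivelyOpen U ↔ ∃ e, U = effOpen e := by
  constructor
  · rintro ⟨S, hS, rfl⟩
    obtain ⟨c, hc⟩ := Nat.Partrec.Code.exists_code.1 hS
    refine ⟨Encodable.encode c, ?_⟩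
    have h : ceSet (Encodable.encode c) = S := by
      ext σ
      simp [ceSet, hc, Part.assert, Part.bind]
    rw [effOpen, h]
  · rintro ⟨e, rfl⟩
    refine ⟨ceSet e, ?_, rfl⟩
    have h : Partrec (fun σ : List Bool =>
        (Nat.Partrec.Code.eval (Denumerable.ofNat Nat.Partrec.Code e)) (Encodable.encode σ)) :=
      Nat.Partrec.Code.eval_part.comp (Computable.const _) Computable.encode
    exact h.dom_re

/-- The uniform (Lebesgue) measure on `2^ω`: the bits are independent fair coin tosses. -/
noncomputable def lebesgue : MeasureTheory.Measure Cantor :=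
  MeasureTheory.Measure.infinitePi (fun _ : ℕ => (PMF.uniformOfFintype Bool).toMeasure)

/-- `g` is `ω`-c.a.: it is the pointwise limit of a computable function `a n s` such that, for some
computable `h` and all `n`, there are at most `h n` stages `s` with `a n s ≠ a n (s + 1)`. -/
def OmegaCA (g : ℕ → ℕ) : Prop :=
  ∃ (a : ℕ → ℕ → ℕ) (h : ℕ → ℕ), Computable₂ a ∧ Computable h ∧
    (∀ n, ∀ᶠ s in Filter.atTop, a n s = g n) ∧
    (∀ n, {s | a n s ≠ a n (s + 1)}.encard ≤ h n)

/-- `g` gives a Demuth test `n ↦ effOpen (g n)`. -/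
def IsDemuthTest (g : ℕ → ℕ) : Prop :=
  OmegaCA g ∧ ∀ n, lebesgue (effOpen (g n)) ≤ (2 : ENNReal)⁻¹ ^ n

/-- `X` is Demuth random: it belongs to at most finitely many levels of any given Demuth test. -/
def DemuthRandom (X : Cantor) : Prop :=
  ∀ g : ℕ → ℕ, IsDemuthTest g → {n | X ∈ effOpen (g n)}.Finite

/-- `X` is `1`-generic: for every effectively open `U`, it belongs to `U` or to the complement of
the closure of `U`. -/
def OneGeneric (X : Cantor) : Prop :=
  ∀ U : Set Cantor, EffectivelyOpen U → X ∈ U ∪ (closure U)ᶜ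

/-- A binary sequence as a total `0`-`1`-valued function on the natural numbers. -/
def toFun (X : Cantor) : ℕ →. ℕ :=
  fun n => Part.some (X n).toNat

/-- `X` computes `Y`: `Y` is Turing reducible to `X`. -/
def Computes (X Y : Cantor) : Prop :=
  TuringReducible (toFun Y) (toFun X)

end DemuthGeneric

/-! This is a fireworks argument. For each partial computable function φ_e, the sequence Y under
construction must have a prefix p such that φ_e diverges at p, or φ_e(p) converges and Y continues p
by the string it codes. Applied to a φ_e that searches for extensions into an effectively open set,
this is 1-genericity (`oneGeneric_of_run`). Requirement e guesses passively that φ_e diverges at the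
current string and lets the others proceed; a convergence refutes the guess and a new one is made.
After `k e` refuted passive guesses it turns active: all work stops until φ_e converges at the
current string, and the extension is taken. Every requirement is met unless an active guess waits
forever (`requirement_met`).

With the other numbers fixed, at most one value of `k e` waits at a given stage: a larger value
treats the same guess as passive and gets no further (`not_active_of_waiting`). So if `k e` is read
from n + 1 bits of the oracle, where n codes the pair (m, e), the oracles waiting at one stage have
measure at most 2^-(n+1) (`lebesgue_waiting_le`). The union over all stages may be larger, since
refuted oracles make room for others. Hence level n starts a new version whenever the measure of the
refuted oracles, in units of 2^-(n+1), reaches a new integer part. There are at most 2^(n+1)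
changes, and within one version less than one unit is newly refuted, so a version has measure at
most 2^-n (`lebesgue_versionSet_le`). The final versions form a Demuth test that captures every
oracle waiting forever. A Demuth random X avoids all levels above some m, and construction m + 1
only involves such levels. -/

namespace DemuthGeneric

open Nat.Partrec (Code)
open MeasureTheory

/-! ### The fireworks construction -/

/-- A stage of the fireworks construction: a pointer selecting the requirement to attend to, the
string built so far, and the log of all guesses, tagged by their requirement. -/
abbrev State : Type := ℕ × List Bool × List (ℕ × List Bool)

/-- The requirement attended to in a given state. -/
def State.req (q : State) : ℕ := (Nat.unpair q.1).1

/-- The guesses made for requirement `e`, in chronological order. -/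
def State.guesses (q : State) (e : ℕ) : List (List Bool) :=
  q.2.2.filterMap fun a => if a.1 = e then some a.2 else none

/-- The value of the `e`-th partial computable function at the string `p`, if found by stage `s`. -/
def find (s e : ℕ) (p : List Bool) : Option ℕ :=
  Code.evaln s (Denumerable.ofNat Code e) (Encodable.encode p)

/-- The value found by stage `s` at the latest guess of the current requirement; the default `0`
forces a first guess when there is none. -/
def State.found (q : State) (s : ℕ) : Option ℕ :=
  Option.casesOn ((q.guesses q.req)[(q.guesses q.req).length - 1]?) (some 0) (find s q.req)

/-- The string with code `v`, or the empty string if there is none. -/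
def toStr (v : ℕ) : List Bool := (Encodable.decode v).getD []

/-- One step of the construction at stage `s`, where the current requirement makes `K` passive
guesses before its active one. -/
def step (s K : ℕ) (q : State) : State :=
  if K + 1 < (q.guesses q.req).length then (q.1 + 1, q.2.1 ++ [false], q.2.2)
  else if (q.guesses q.req).length = K + 1 then
    Option.casesOn (q.found s) q fun v =>
      -- The additional log entry only marks the requirement as met: the number of guesses now
      -- exceeds `K + 1`.
      (q.1, q.2.1 ++ toStr v, q.2.2 ++ [(q.req, q.2.1)])
  else
    Option.casesOn (q.found s) (q.1 + 1, q.2.1 ++ [false], q.2.2) fun _ =>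
      (q.1, q.2.1, q.2.2 ++ [(q.req, q.2.1)])

/-- The construction after `s` steps, with `k e` passive guesses for requirement `e`. -/
def run (k : ℕ → ℕ) (s : ℕ) : State :=
  Nat.rec (0, [], []) (fun s q => step s (k q.req) q) s

theorem run_zero (k : ℕ → ℕ) : run k 0 = (0, [], []) := rfl

theorem run_succ (k : ℕ → ℕ) (s : ℕ) :
    run k (s + 1) = step s (k (run k s).req) (run k s) := rfl

theorem guesses_push (j e e' : ℕ) (σ τ : List Bool) (l : List (ℕ × List Bool)) :
    State.guesses (j, σ, l ++ [(e, τ)]) e' =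
      State.guesses (j, σ, l) e' ++ if e = e' then [τ] else [] := by
  by_cases h : e = e' <;> simp [State.guesses, h]

theorem guesses_eq (j j' e : ℕ) (σ σ' : List Bool) (l : List (ℕ × List Bool)) :
    State.guesses (j, σ, l) e = State.guesses (j', σ', l) e := rfl

theorem find_mono {s t e : ℕ} {p : List Bool} {v : ℕ} (h : s ≤ t) (hv : find s e p = some v) :
    find t e p = some v :=
  Code.evaln_mono h hv

/-- The four possible effects of a step. -/
theorem step_cases (s K : ℕ) (q : State) :
    (step s K q = (q.1 + 1, q.2.1 ++ [false], q.2.2) ∧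
      (K + 1 < (q.guesses q.req).length ∨ (q.guesses q.req).length ≤ K ∧
        ∃ p, (q.guesses q.req)[(q.guesses q.req).length - 1]? = some p ∧
          find s q.req p = none)) ∨
    (step s K q = q ∧ (q.guesses q.req).length = K + 1 ∧
        ∃ p, (q.guesses q.req)[K]? = some p ∧ find s q.req p = none) ∨
    (step s K q = (q.1, q.2.1, q.2.2 ++ [(q.req, q.2.1)]) ∧ (q.guesses q.req).length ≤ K ∧
        ∀ p, (q.guesses q.req)[(q.guesses q.req).length - 1]? = some p →
          ∃ v, find s q.req p = some v) ∨
    (∃ p v, step s K q =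
        (q.1, q.2.1 ++ toStr v, q.2.2 ++ [(q.req, q.2.1)]) ∧
        (q.guesses q.req).length = K + 1 ∧ (q.guesses q.req)[K]? = some p ∧
          find s q.req p = some v) := by
  unfold step State.found
  split_ifs with h1 h2
  · exact Or.inl ⟨rfl, Or.inl h1⟩
  · have h3 : K < (q.guesses q.req).length := by omega
    have h4 : (q.guesses q.req)[K]? = some ((q.guesses q.req)[K]) := List.getElem?_eq_getElem h3
    simp only [h2, Nat.add_sub_cancel, h4]
    cases h5 : find s q.req (q.guesses q.req)[K] with
    | none => exact Or.inr (Or.inl ⟨rfl, trivial, _, rfl, h5⟩)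
    | some v => exact Or.inr (Or.inr (Or.inr ⟨_, v, rfl, trivial, rfl, h5⟩))
  · have h3 : (q.guesses q.req).length ≤ K := by omega
    cases h4 : (q.guesses q.req)[(q.guesses q.req).length - 1]? with
    | none => exact Or.inr (Or.inr (Or.inl ⟨rfl, h3, by simp⟩))
    | some p =>
      cases h5 : find s q.req p with
      | none => exact Or.inl ⟨by simp [h5], Or.inr ⟨h3, p, rfl, h5⟩⟩
      | some v =>
        refine Or.inr (Or.inr (Or.inl ⟨by simp [h5], h3, ?_⟩))
        rintro p' hp
        cases hp
        exact ⟨v, h5⟩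

/-! ### Invariants of the construction -/

theorem run_prefix_succ (k : ℕ → ℕ) (s : ℕ) : (run k s).2.1 <+: (run k (s + 1)).2.1 := by
  rw [run_succ]
  rcases step_cases s (k (run k s).req) (run k s) with
    ⟨h, -⟩ | ⟨h, -⟩ | ⟨h, -⟩ | ⟨p, v, h, -⟩ <;> rw [h] <;> simp

theorem run_prefix (k : ℕ → ℕ) {s t : ℕ} (h : s ≤ t) : (run k s).2.1 <+: (run k t).2.1 := by
  induction h with
  | refl => exact List.prefix_rfl
  | step _ ih => exact ih.trans (run_prefix_succ k _)

theorem guesses_prefix_succ (k : ℕ → ℕ) (s e : ℕ) :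
    (run k s).guesses e <+: (run k (s + 1)).guesses e := by
  rw [run_succ]
  rcases step_cases s (k (run k s).req) (run k s) with
    ⟨h, -⟩ | ⟨h, -⟩ | ⟨h, -⟩ | ⟨p, v, h, -⟩ <;> rw [h]
  · exact List.prefix_rfl
  · rw [guesses_push]; exact List.prefix_append _ _
  · rw [guesses_push]; exact List.prefix_append _ _

theorem guesses_prefix (k : ℕ → ℕ) {s t : ℕ} (h : s ≤ t) (e : ℕ) :
    (run k s).guesses e <+: (run k t).guesses e := by
  induction h with
  | refl => exact List.prefix_rfl
  | step _ ih => exact ih.trans (guesses_prefix_succ k _ e)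

theorem getElem?_of_prefix {α : Type*} {l l' : List α} (h : l <+: l') {i : ℕ} {a : α}
    (ha : l[i]? = some a) : l'[i]? = some a := by
  obtain ⟨r, rfl⟩ := h
  have hi : i < l.length := (List.getElem?_eq_some_iff.1 ha).1
  rw [List.getElem?_append_left hi, ha]

theorem ptr_le (k : ℕ → ℕ) (s : ℕ) : (run k s).1 ≤ s := by
  induction s with
  | zero => simp [run_zero]
  | succ s ih =>
    rw [run_succ]
    rcases step_cases s (k (run k s).req) (run k s) with
      ⟨h, -⟩ | ⟨h, -⟩ | ⟨h, -⟩ | ⟨p, v, h, -⟩ <;> rw [h] <;> (try simp) <;> omega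

theorem req_le (k : ℕ → ℕ) (s : ℕ) : (run k s).req ≤ s :=
  (Nat.unpair_left_le _).trans (ptr_le k s)

/-- The pointer moves by at most one per step, so before stage `s` only requirements below `s` are
consulted. This gives each stage a finite use of the oracle. -/
theorem run_congr {k k' : ℕ → ℕ} {s : ℕ} (h : ∀ e < s, k e = k' e) : run k s = run k' s := by
  induction s with
  | zero => rfl
  | succ s ih =>
    have ih := ih fun e he => h e (by omega)
    rw [run_succ, run_succ, ← ih, h _ (Nat.lt_succ_of_le (req_le k s))]

/-- Each advance of the pointer appends a bit, so an unbounded pointer makes the limit sequence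
total. -/
theorem ptr_le_length (k : ℕ → ℕ) (s : ℕ) : (run k s).1 ≤ (run k s).2.1.length := by
  induction s with
  | zero => simp [run_zero]
  | succ s ih =>
    rw [run_succ]
    rcases step_cases s (k (run k s).req) (run k s) with
      ⟨h, -⟩ | ⟨h, -⟩ | ⟨h, -⟩ | ⟨p, v, h, -⟩ <;> rw [h] <;> (try simp) <;> omega

theorem guess_prefix_str (k : ℕ → ℕ) (s e : ℕ) :
    ∀ p ∈ (run k s).guesses e, p <+: (run k s).2.1 := by
  induction s with
  | zero => simp [run_zero, State.guesses]
  | succ s ih =>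
    intro p hp
    by_cases hp' : p ∈ (run k s).guesses e
    · exact (ih p hp').trans (run_prefix_succ k s)
    · suffices p = (run k s).2.1 from this ▸ run_prefix_succ k s
      rw [run_succ] at hp
      rcases step_cases s (k (run k s).req) (run k s) with
        ⟨h, -⟩ | ⟨h, -⟩ | ⟨h, -⟩ | ⟨p, v, h, -⟩ <;> rw [h] at hp
      · exact absurd hp hp'
      · exact absurd hp hp'
      all_goals
        rw [guesses_push, List.mem_append] at hp
        rcases hp with hp | hp
        · exact absurd hp hp'
        · split_ifs at hp <;> simp_all

/-- The list holds `k e` passive guesses, one active guess and the final marker. -/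
theorem length_guesses_le (k : ℕ → ℕ) (s e : ℕ) :
    ((run k s).guesses e).length ≤ k e + 2 := by
  induction s with
  | zero => simp [run_zero, State.guesses]
  | succ s ih =>
    rw [run_succ]
    rcases step_cases s (k (run k s).req) (run k s) with
      ⟨h, -⟩ | ⟨h, -⟩ | ⟨h, h', -⟩ | ⟨p, v, h, h', -⟩ <;> rw [h]
    · exact ih
    · exact ih
    all_goals
      rw [guesses_push]
      by_cases he : (run k s).req = e
      · rw [he] at h'
        simp only [he, if_true, List.length_append, List.length_singleton]
        change ((run k s).guesses e).length + 1 ≤ _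
        omega
      · simp only [he, if_false, List.append_nil]
        exact ih

/-- While requirement `e` makes its active guess, it has the attention and its guess is the
current string. -/
theorem active_guess (k : ℕ → ℕ) (s e : ℕ) (hs : ((run k s).guesses e).length = k e + 1) :
    (run k s).req = e ∧ ((run k s).guesses e)[k e]? = some (run k s).2.1 := by
  induction s with
  | zero => simp [run_zero, State.guesses] at hs
  | succ s ih =>
    rw [run_succ] at hs ⊢
    rcases step_cases s (k (run k s).req) (run k s) with
      ⟨h, h'⟩ | ⟨h, -⟩ | ⟨h, h', -⟩ | ⟨p, v, h, h', -⟩ <;> rw [h] at hs ⊢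
    · have hs : ((run k s).guesses e).length = k e + 1 := hs
      obtain ⟨h1, -⟩ := ih hs
      rw [h1] at h'
      omega
    · exact ih hs
    all_goals
      rw [guesses_push] at hs ⊢
      rw [guesses_eq _ (run k s).1 _ _ (run k s).2.1] at hs ⊢
      change (_ : List _).length = _ at hs
      change (run k s).req = e ∧ _
      by_cases he : (run k s).req = e
      · subst he
        simp only [if_true, List.length_append, List.length_singleton] at hs
        change ((run k s).guesses (run k s).req).length + 1 = _ at hs
        first
        | refine ⟨rfl, ?_⟩
          have : k (run k s).req = ((run k s).guesses (run k s).req).length := by omega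
          simp only [if_true, this]
          exact List.getElem?_concat_length
        | omega
      · simp only [he, if_false, List.append_nil] at hs
        have := (ih hs).1
        contradiction

/-- A requirement that has finished its active guess is met. -/
theorem won_guess (k : ℕ → ℕ) (s e : ℕ) (hs : k e + 1 < ((run k s).guesses e).length) :
    ∃ p v, v ∈ (Denumerable.ofNat Code e).eval (Encodable.encode p) ∧
      p ++ toStr v <+: (run k s).2.1 := by
  induction s with
  | zero => simp [run_zero, State.guesses] at hs
  | succ s ih =>
    by_cases hs' : k e + 1 < ((run k s).guesses e).length
    · obtain ⟨p, v, h1, h2⟩ := ih hs'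
      exact ⟨p, v, h1, h2.trans (run_prefix_succ k s)⟩
    · rw [run_succ] at hs ⊢
      rcases step_cases s (k (run k s).req) (run k s) with
        ⟨h, h'⟩ | ⟨h, -⟩ | ⟨h, h', -⟩ | ⟨p, v, h, h', h1, h2⟩ <;> rw [h] at hs ⊢
      · exact absurd hs hs'
      · exact absurd hs hs'
      all_goals
        rw [guesses_push] at hs
        by_cases he : (run k s).req = e
        · subst he
          simp only [if_true, List.length_append, List.length_singleton] at hs
          change _ < ((run k s).guesses (run k s).req).length + 1 at hs
          first
          | omega
          | obtain ⟨-, h3⟩ := active_guess k s _ h'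
            rw [h3] at h1
            cases h1
            exact ⟨_, v, Code.evaln_sound h2, List.prefix_rfl⟩
        · simp only [he, if_false, List.append_nil] at hs
          exact absurd hs hs'

/-! ### Waiting at an active guess -/

/-- The active guess of requirement `e` is made by stage `s`. -/
def Active (k : ℕ → ℕ) (e s : ℕ) : Prop := ∃ p, ((run k s).guesses e)[k e]? = some p

/-- The active guess of requirement `e` is made and refuted by stage `s`. -/
def Refuted (k : ℕ → ℕ) (e s : ℕ) : Prop :=
  ∃ p, ((run k s).guesses e)[k e]? = some p ∧ (find s e p).isSome

theorem Active.mono {k : ℕ → ℕ} {e s t : ℕ} (h : Active k e s) (hst : s ≤ t) : Active k e t :=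
  h.imp fun _ hp => getElem?_of_prefix (guesses_prefix k hst e) hp

theorem Refuted.mono {k : ℕ → ℕ} {e s t : ℕ} (h : Refuted k e s) (hst : s ≤ t) :
    Refuted k e t := by
  obtain ⟨p, hp, hf⟩ := h
  obtain ⟨v, hv⟩ := Option.isSome_iff_exists.1 hf
  exact ⟨p, getElem?_of_prefix (guesses_prefix k hst e) hp, by simp [find_mono hst hv]⟩

theorem active_congr {k k' : ℕ → ℕ} {e s : ℕ} (h : ∀ i ≤ s + e, k i = k' i) :
    Active k e s ↔ Active k' e s := by
  rw [Active, Active, run_congr fun i hi => h i (by omega), h e (by omega)]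

theorem refuted_congr {k k' : ℕ → ℕ} {e s : ℕ} (h : ∀ i ≤ s + e, k i = k' i) :
    Refuted k e s ↔ Refuted k' e s := by
  rw [Refuted, Refuted, run_congr fun i hi => h i (by omega), h e (by omega)]

/-- Two constructions that differ only in requirement `e` agree until the smaller number of
passive guesses is used up, and the one with more passive guesses then keeps its guess as long as
the other one waits. -/
theorem run_compare {k k' : ℕ → ℕ} {e : ℕ} (h : ∀ i, i ≠ e → k i = k' i) (hlt : k e < k' e)
    (s : ℕ) :
    (run k s = run k' s ∧ ((run k s).guesses e).length ≤ k e) ∨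
    ∃ p, ((run k s).guesses e)[k e]? = some p ∧ ((run k' s).guesses e)[k e]? = some p ∧
      (((run k' s).guesses e).length = k e + 1 ∨ (find s e p).isSome) := by
  induction s with
  | zero => left; simp [run_zero, State.guesses]
  | succ s ih =>
    rcases ih with ⟨h1, h2⟩ | ⟨p, h1, h2, h3⟩
    · have h4 : run k (s + 1) = run k' (s + 1) := by
        rw [run_succ, run_succ, ← h1]
        by_cases he : (run k s).req = e
        -- With at most `k e` guesses made, both constructions are in the passive branch of `step`,
        -- which ignores `K`.
        · rw [step, step, he, if_neg (by omega), if_neg (by omega), if_neg (by omega),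
            if_neg (by omega)]
        · rw [h _ he]
      by_cases h5 : ((run k (s + 1)).guesses e).length ≤ k e
      · exact Or.inl ⟨h4, h5⟩
      · right
        have h6 : ((run k (s + 1)).guesses e).length ≤ ((run k s).guesses e).length + 1 := by
          rw [run_succ]
          rcases step_cases s (k (run k s).req) (run k s) with
            ⟨h, -⟩ | ⟨h, -⟩ | ⟨h, -⟩ | ⟨p, v, h, -⟩ <;> rw [h]
          · exact Nat.le_succ _
          · exact Nat.le_succ _
          all_goals
            rw [guesses_push]
            split_ifs
            · simp [State.guesses]
            · simp [State.guesses]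
        have h7 : k e < ((run k (s + 1)).guesses e).length := by omega
        -- The guess just made has index `k e`: it is active for `k` and still passive for `k'`.
        refine ⟨((run k (s + 1)).guesses e)[k e], List.getElem?_eq_getElem h7, ?_, Or.inl ?_⟩
        · rw [← h4]; exact List.getElem?_eq_getElem h7
        · rw [← h4]; omega
    · right
      refine ⟨p, getElem?_of_prefix (guesses_prefix_succ k s e) h1,
        getElem?_of_prefix (guesses_prefix_succ k' s e) h2, ?_⟩
      by_cases h4 : (find s e p).isSome
      · obtain ⟨v, hv⟩ := Option.isSome_iff_exists.1 h4
        right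
        simp [find_mono (Nat.le_succ s) hv]
      · have h3 := h3.resolve_right h4
        left
        rw [run_succ]
        -- A further entry for `e` requires a value at `p`, or a list of length `k' e + 1`, which
        -- exceeds the present `k e + 1`.
        rcases step_cases s (k' (run k' s).req) (run k' s) with
          ⟨h, -⟩ | ⟨h, -⟩ | ⟨h, h5, h6⟩ | ⟨p', v, h, h5, -⟩ <;> rw [h]
        · exact h3
        · exact h3
        · rw [guesses_push]
          by_cases he : (run k' s).req = e
          · rw [he, h3, Nat.add_sub_cancel] at h6
            obtain ⟨v, hv⟩ := h6 p h2
            simp [hv] at h4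
          · simp only [he, if_false, List.append_nil]
            exact h3
        · rw [guesses_push]
          by_cases he : (run k' s).req = e
          · rw [he] at h5
            omega
          · simp only [he, if_false, List.append_nil]
            exact h3

/-- At any stage, requirement `e` waits for at most one value of its number of passive guesses. -/
theorem not_active_of_waiting {k k' : ℕ → ℕ} {e : ℕ} (h : ∀ i, i ≠ e → k i = k' i)
    (hlt : k e < k' e) {s : ℕ} (ha : Active k e s) (hr : ¬ Refuted k e s) : ¬ Active k' e s := by
  rintro ⟨p', hp'⟩
  obtain ⟨q, hq⟩ := ha
  rcases run_compare h hlt s with ⟨-, h2⟩ | ⟨p, h1, h2, h3⟩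
  · rw [List.getElem?_eq_none h2] at hq
    cases hq
  · have h4 : ¬ (find s e p).isSome := fun h4 => hr ⟨p, h1, h4⟩
    have h3 := h3.resolve_right h4
    rw [List.getElem?_eq_none (by omega)] at hp'
    cases hp'

/-! ### Success when nothing waits forever -/

/-- If no requirement waits forever, the pointer always advances. -/
theorem exists_ptr_succ {k : ℕ → ℕ} (H : ∀ e s, Active k e s → ∃ t, Refuted k e t) (s : ℕ) :
    ∃ t, s ≤ t ∧ (run k t).1 = (run k s).1 ∧ (run k (t + 1)).1 = (run k t).1 + 1 := by
  -- `d` bounds the log entries the current requirement can still add. Each new entry lowers it.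
  obtain ⟨d, hd⟩ : ∃ d, d = k (run k s).req + 2 - ((run k s).guesses (run k s).req).length :=
    ⟨_, rfl⟩
  induction d using Nat.strong_induction_on generalizing s with
  | _ d ih =>
  have key : ∀ t, s ≤ t → (run k t).1 = (run k s).1 →
      ((run k s).guesses (run k s).req).length < ((run k t).guesses (run k s).req).length →
      ∃ t, s ≤ t ∧ (run k t).1 = (run k s).1 ∧ (run k (t + 1)).1 = (run k t).1 + 1 := by
    intro t hst ht hlt
    have hreq : (run k t).req = (run k s).req := by rw [State.req, ht, State.req]
    have := length_guesses_le k t (run k s).req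
    obtain ⟨t', h1, h2, h3⟩ := ih _ (by rw [hd, hreq]; omega) t rfl
    exact ⟨t', hst.trans h1, h2.trans ht, h3⟩
  rcases step_cases s (k (run k s).req) (run k s) with
    ⟨h, -⟩ | ⟨h, h', p, hp, -⟩ | ⟨h, h', -⟩ | ⟨p, v, h, h', -⟩
  · exact ⟨s, le_rfl, rfl, by rw [run_succ, h]⟩
  · obtain ⟨t, ht⟩ := H _ s ⟨p, hp⟩
    -- A state frozen forever is impossible: once the active guess is refuted, the next step acts on
    -- it.
    have hts : ∃ t, s ≤ t ∧ run k t ≠ run k s := by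
      by_contra! hc
      obtain ⟨p', hp', hf⟩ := ht.mono (le_max_left t s)
      have h1 := hc (max t s) (le_max_right _ _)
      have h2 := hc (max t s + 1) (le_max_of_le_right le_rfl |>.trans (Nat.le_succ _))
      rw [run_succ, h1] at h2
      rw [h1] at hp'
      rcases step_cases (max t s) (k (run k s).req) (run k s) with
        ⟨h, -⟩ | ⟨-, -, p'', h3, h4⟩ | ⟨h, -⟩ | ⟨p, v, h, -⟩
      · rw [h] at h2
        have := congrArg Prod.fst h2
        simp at this
      · rw [hp'] at h3
        cases h3
        simp [h4] at hf
      · rw [h] at h2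
        have := congrArg (fun q : State => q.2.2.length) h2
        simp at this
      · rw [h] at h2
        have := congrArg (fun q : State => q.2.2.length) h2
        simp at this
    classical
    have hsp := Nat.find_spec hts
    have hmin := fun m => Nat.find_min hts (m := m)
    obtain ⟨u, hu⟩ : ∃ u, Nat.find hts = u + 1 := by
      rcases hn : Nat.find hts with _ | u
      · rw [hn] at hsp
        have : s = 0 := by omega
        subst this
        exact absurd rfl hsp.2
      · exact ⟨u, rfl⟩
    rw [hu] at hsp hmin
    have hsu : s ≤ u := by
      rcases Nat.lt_or_ge u s with h5 | h5
      · have : u + 1 = s := by omega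
        rw [this] at hsp
        exact absurd rfl hsp.2
      · exact h5
    have hus : run k u = run k s := by
      by_contra hne
      exact hmin u (Nat.lt_succ_self u) ⟨hsu, hne⟩
    have hstep := hsp.2
    rw [run_succ, hus] at hstep
    rcases step_cases u (k (run k s).req) (run k s) with
        ⟨h1, h2⟩ | ⟨h1, -⟩ | ⟨h1, h2, -⟩ | ⟨p, v, h1, -⟩
    · omega
    · exact absurd h1 hstep
    · omega
    · refine key (u + 1) hsp.1 ?_ ?_
      · rw [run_succ, hus, h1]
      · rw [run_succ, hus, h1, guesses_push]
        simp [State.guesses]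
  · refine key (s + 1) (Nat.le_succ s) ?_ ?_
    · rw [run_succ, h]
    · rw [run_succ, h, guesses_push]
      simp [State.guesses]
  · refine key (s + 1) (Nat.le_succ s) ?_ ?_
    · rw [run_succ, h]
    · rw [run_succ, h, guesses_push]
      simp [State.guesses]

/-- If no requirement waits forever, each one acts at arbitrarily late stages by advancing. -/
theorem exists_advance {k : ℕ → ℕ} (H : ∀ e s, Active k e s → ∃ t, Refuted k e t) (j : ℕ) :
    ∃ t, (run k t).1 = j ∧ (run k (t + 1)).1 = (run k t).1 + 1 := by
  induction j with
  | zero =>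
    obtain ⟨t, -, h1, h2⟩ := exists_ptr_succ H 0
    exact ⟨t, h1, h2⟩
  | succ j ih =>
    obtain ⟨s, h1, h2⟩ := ih
    obtain ⟨t, -, h3, h4⟩ := exists_ptr_succ H (s + 1)
    exact ⟨t, by rw [h3, h2, h1], h4⟩

/-- If no requirement waits forever, every requirement is met. -/
theorem requirement_met {k : ℕ → ℕ} (H : ∀ e s, Active k e s → ∃ t, Refuted k e t) (e : ℕ) :
    ∃ s p, p <+: (run k s).2.1 ∧
      ∀ v ∈ (Denumerable.ofNat Code e).eval (Encodable.encode p),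
        p ++ toStr v <+: (run k s).2.1 := by
  by_contra! hc
  have hnw : ∀ s, ((run k s).guesses e).length ≤ k e + 1 := by
    intro s
    by_contra hlt
    obtain ⟨p, v, h1, h2⟩ := won_guess k s e (by omega)
    obtain ⟨w, hw, hw'⟩ := hc s p ((List.prefix_append _ _).trans h2)
    exact hw' (Part.mem_unique hw h1 ▸ h2)
  -- If the requirement fails, the function converges at every prefix of the construction, so every
  -- guess is eventually refuted.
  have hdown : ∀ s p, p <+: (run k s).2.1 → ∃ t₀, ∀ t ≥ t₀, (find t e p).isSome := by
    intro s p hp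
    obtain ⟨v, hv, -⟩ := hc s p hp
    obtain ⟨t, ht⟩ := Code.evaln_complete.1 hv
    exact ⟨t, fun t' ht' => Option.isSome_iff_exists.2 ⟨v, find_mono ht' ht⟩⟩
  obtain ⟨s, hs⟩ : ∃ s, ∀ t ≥ s, ((run k t).guesses e).length = ((run k s).guesses e).length := by
    have hmono : Monotone fun s => ((run k s).guesses e).length :=
      fun s t h => (guesses_prefix k h e).length_le
    by_contra! hcc
    have : ∀ n, ∃ s, n ≤ ((run k s).guesses e).length := by
      intro n
      induction n with
      | zero => exact ⟨0, Nat.zero_le _⟩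
      | succ n ih =>
        obtain ⟨s, hs⟩ := ih
        obtain ⟨t, ht, hne⟩ := hcc s
        have := hmono ht
        exact ⟨t, by simp only at this; omega⟩
    obtain ⟨s, hs⟩ := this (k e + 2)
    have := hnw s
    omega
  have hG : ∀ t ≥ s, (run k t).guesses e = (run k s).guesses e := fun t ht =>
    ((guesses_prefix k ht e).eq_of_length (hs t ht).symm).symm
  obtain ⟨t₀, ht₀⟩ : ∃ t₀, ∀ t ≥ t₀, ∀ p ∈ (run k s).guesses e, (find t e p).isSome := by
    have : ∀ p ∈ (run k s).guesses e, ∀ᶠ t in Filter.atTop, (find t e p).isSome :=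
      fun p hp => Filter.eventually_atTop.2 (hdown s p (guess_prefix_str k s e p hp))
    have := (Filter.eventually_all_finite ((run k s).guesses e).finite_toSet).2 this
    exact Filter.eventually_atTop.1 this
  -- This pointer value attends to `e` and, as the pointer never exceeds the stage, is reached only
  -- after the list of guesses has settled and been refuted. Advancing then needs an unrefuted guess
  -- or a met requirement.
  obtain ⟨t, ht, hadv⟩ := exists_advance H (Nat.pair e (max s t₀))
  have htle : max s t₀ ≤ t := by
    have h1 := Nat.right_le_pair e (max s t₀)
    have h2 := ptr_le k t
    omega
  have hreq : (run k t).req = e := by rw [State.req, ht, Nat.unpair_pair]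
  rw [run_succ] at hadv
  rcases step_cases t (k (run k t).req) (run k t) with
      ⟨h1, h2⟩ | ⟨h1, -⟩ | ⟨h1, h2, -⟩ | ⟨p, v, h1, -⟩
  · rw [hreq] at h2
    rcases h2 with h2 | ⟨-, p, h3, h4⟩
    · have := hnw t
      omega
    · have hmem : p ∈ (run k t).guesses e := List.mem_of_getElem? h3
      rw [hG t (le_trans (le_max_left _ _) htle)] at hmem
      have := ht₀ t (le_trans (le_max_right _ _) htle) p hmem
      simp [h4] at this
  all_goals
    rw [h1] at hadv
    simp at hadv

theorem exists_length_gt {k : ℕ → ℕ} (H : ∀ e s, Active k e s → ∃ t, Refuted k e t) (i : ℕ) :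
    ∃ t, i < (run k t).2.1.length := by
  obtain ⟨t, h1, -⟩ := exists_advance H (i + 1)
  have := ptr_le_length k t
  exact ⟨t, by omega⟩

/-! ### Measure of sets decided by finitely many bits -/

/-- The number whose binary digits are the first `u` bits of `X`, lowest digit first. -/
def num (X : Cantor) (u : ℕ) : ℕ := Nat.rec 0 (fun i x => 2 ^ i * (X i).toNat + x) u

theorem num_succ (X : Cantor) (u : ℕ) : num X (u + 1) = 2 ^ u * (X u).toNat + num X u := rfl

theorem num_lt (X : Cantor) (u : ℕ) : num X u < 2 ^ u := by
  induction u with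
  | zero => simp [num]
  | succ u ih =>
    rw [num_succ, pow_succ]
    cases X u <;> simp <;> omega

theorem testBit_num (X : Cantor) {u i : ℕ} (h : i < u) : (num X u).testBit i = X i := by
  induction u with
  | zero => omega
  | succ u ih =>
    rw [num_succ, Nat.testBit_two_pow_mul_add _ (num_lt X u)]
    split_ifs with hi
    · exact ih hi
    · have : i = u := by omega
      subst this
      cases X i <;> simp

theorem num_eq_iff (X : Cantor) {u x : ℕ} (hx : x < 2 ^ u) :
    num X u = x ↔ ∀ i < u, X i = x.testBit i := by
  constructor
  · rintro rfl i hi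
    exact (testBit_num X hi).symm
  · intro h
    refine Nat.eq_of_testBit_eq fun i => ?_
    by_cases hi : i < u
    · rw [testBit_num X hi, h i hi]
    · have h2 : 2 ^ u ≤ 2 ^ i := Nat.pow_le_pow_right (by norm_num) (by omega)
      rw [Nat.testBit_lt_two_pow ((num_lt X u).trans_le h2), Nat.testBit_lt_two_pow (hx.trans_le h2)]

instance : IsProbabilityMeasure lebesgue := by unfold lebesgue; infer_instance

theorem uniform_singleton (b : Bool) :
    (PMF.uniformOfFintype Bool).toMeasure {b} = (2 : ENNReal)⁻¹ := by
  rw [PMF.toMeasure_apply_singleton _ _ (measurableSet_singleton b)]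
  simp

theorem setOf_num_eq (u : ℕ) {x : ℕ} (hx : x < 2 ^ u) :
    {X : Cantor | num X u = x} = Set.pi (Finset.range u) fun i => {x.testBit i} := by
  ext X
  simp [num_eq_iff X hx, Set.mem_pi]

theorem lebesgue_num_eq (u : ℕ) {x : ℕ} (hx : x < 2 ^ u) :
    lebesgue {X | num X u = x} = (2 : ENNReal)⁻¹ ^ u := by
  rw [setOf_num_eq u hx, lebesgue, Measure.infinitePi_pi _ fun _ _ => measurableSet_singleton _]
  simp only [uniform_singleton, Finset.prod_const, Finset.card_range]

theorem measurable_num (u : ℕ) : Measurable fun X : Cantor => num X u := by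
  induction u with
  | zero => exact measurable_const
  | succ u ih =>
    simp only [num_succ]
    exact ((measurable_of_countable fun b : Bool => 2 ^ u * b.toNat).comp
      (measurable_pi_apply u)).add ih

theorem measurableSet_num (u : ℕ) (P : ℕ → Prop) : MeasurableSet {X : Cantor | P (num X u)} :=
  measurable_num u (MeasurableSet.of_discrete (s := {x | P x}))

theorem lebesgue_setOf_num (u : ℕ) (P : ℕ → Prop) [DecidablePred P] :
    lebesgue {X | P (num X u)} = Nat.count P (2 ^ u) * (2 : ENNReal)⁻¹ ^ u := by
  have h : {X : Cantor | P (num X u)} =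
      ⋃ x ∈ (Finset.range (2 ^ u)).filter P, {X | num X u = x} := by
    ext X
    simp [num_lt X u]
  rw [h, measure_biUnion_finset]
  · rw [Finset.sum_congr rfl fun x hx => lebesgue_num_eq u
      (Finset.mem_range.1 (Finset.mem_filter.1 hx).1), Finset.sum_const, nsmul_eq_mul,
      Nat.count_eq_card_filter_range]
  · intro x _ y _ hxy
    rw [Function.onFun, Set.disjoint_left]
    rintro X rfl h
    exact hxy h
  · intro x _
    exact measurableSet_num u fun y => y = x

/-- Negate the bits in a given set of positions. -/
def flip (T : Finset ℕ) (X : Cantor) : Cantor := fun i => if i ∈ T then !(X i) else X i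

theorem measurePreserving_flip (T : Finset ℕ) : MeasurePreserving (flip T) lebesgue lebesgue := by
  let f : ℕ → Bool → Bool := fun i b => if i ∈ T then !b else b
  have hf : ∀ i, Measurable (f i) := fun i => measurable_of_countable _
  refine ⟨measurable_pi_lambda _ fun i => (hf i).comp (measurable_pi_apply i), ?_⟩
  have h := Measure.infinitePi_map_pi
    (μ := fun _ : ℕ => (PMF.uniformOfFintype Bool).toMeasure) hf
  have h2 : ∀ i, (PMF.uniformOfFintype Bool).toMeasure.map (f i) =
      (PMF.uniformOfFintype Bool).toMeasure := by
    intro i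
    refine Measure.ext_of_singleton fun b => ?_
    rw [Measure.map_apply (hf i) (measurableSet_singleton b), uniform_singleton]
    have : f i ⁻¹' {b} = {f i b} := by
      ext c
      simp only [f]
      split_ifs <;> cases b <;> cases c <;> simp
    rw [this, uniform_singleton]
  simp only [h2] at h
  exact h

/-- A set whose elements are determined by their bits outside `F` is small. -/
theorem lebesgue_le_of_determined {E : Set Cantor} (hE : MeasurableSet E) (F : Finset ℕ)
    (h : ∀ X ∈ E, ∀ Y ∈ E, (∀ i ∉ F, X i = Y i) → X = Y) :
    lebesgue E ≤ (2 : ENNReal)⁻¹ ^ F.card := by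
  -- The `2 ^ F.card` images of `E` under flips inside `F` are disjoint and equal in measure.
  have h1 : lebesgue (⋃ T ∈ F.powerset, flip T ⁻¹' E) = (2 : ENNReal) ^ F.card * lebesgue E := by
    rw [measure_biUnion_finset]
    · rw [Finset.sum_congr rfl fun T _ => (measurePreserving_flip T).measure_preimage
        hE.nullMeasurableSet]
      simp
    · intro T hT T' hT' hne
      rw [Function.onFun, Set.disjoint_left]
      intro X hX hX'
      rw [Finset.mem_coe, Finset.mem_powerset] at hT hT'
      have h2 := h _ hX _ hX' fun i hi => by
        rw [flip, flip, if_neg fun h => hi (hT h), if_neg fun h => hi (hT' h)]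
      refine hne (Finset.ext fun i => ?_)
      have h3 := congrFun h2 i
      simp only [flip] at h3
      by_cases h4 : i ∈ T <;> by_cases h5 : i ∈ T' <;> simp [h4, h5] at h3 ⊢
    · exact fun T _ => (measurePreserving_flip T).measurable hE
  have h2 : (2 : ENNReal) ^ F.card * lebesgue E ≤ 1 := h1 ▸ prob_le_one
  rw [← ENNReal.inv_pow]
  rw [mul_comm] at h2
  exact ENNReal.le_inv_iff_mul_le.2 h2

/-- Measure bound for one version of a level of the test. -/
theorem measure_version_le {Ω : Type*} [MeasurableSpace Ω] (μ : Measure Ω) [IsFiniteMeasure μ]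
    {A B : ℕ → Set Ω} (hA : Monotone A) (hB : Monotone B) (hBm : ∀ s, MeasurableSet (B s))
    {ε δ : ENNReal} (hε : ∀ s, μ (A s \ B s) ≤ ε) (v : ℕ → ℕ)
    (hv : ∀ s t, s ≤ t → v s = v t → μ (B t) ≤ μ (B s) + δ) (w : ℕ) :
    μ (⋃ s ∈ {s | v s = w}, A s \ B s) ≤ ε + δ := by
  classical
  by_cases hw : ∃ s, v s = w
  · have h0 : v (Nat.find hw) = w := Nat.find_spec hw
    -- Removing only the refuted part of the first stage of version `w` makes the union increasing,
    -- so its measure is a supremum.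
    have h1 : (⋃ s ∈ {s | v s = w}, A s \ B s) ⊆
        ⋃ s ∈ {s | v s = w}, A s \ B (Nat.find hw) :=
      Set.iUnion₂_mono fun s hs => Set.sdiff_subset_sdiff_right (hB (Nat.find_min' hw hs))
    refine (measure_mono h1).trans ?_
    have hmono : Monotone fun s => A s \ B (Nat.find hw) :=
      fun s t h => Set.sdiff_subset_sdiff_left (hA h)
    rw [measure_biUnion_eq_iSup (Set.to_countable _)]
    · refine iSup₂_le fun t ht => ?_
      have hle := Nat.find_min' hw ht
      have h2 : A t \ B (Nat.find hw) ⊆ (A t \ B t) ∪ (B t \ B (Nat.find hw)) := by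
        rintro X ⟨h3, h4⟩
        by_cases h5 : X ∈ B t
        · exact Or.inr ⟨h5, h4⟩
        · exact Or.inl ⟨h3, h5⟩
      refine (measure_mono h2).trans ((measure_union_le _ _).trans (add_le_add (hε t) ?_))
      rw [measure_sdiff (hB hle) (hBm _).nullMeasurableSet (measure_ne_top _ _)]
      exact tsub_le_iff_left.2 (hv _ _ hle (h0.trans (Eq.symm ht)))
    · intro s hs t ht
      rcases le_total s t with h | h
      · exact ⟨t, ht, hmono h, subset_rfl⟩
      · exact ⟨s, hs, subset_rfl, hmono h⟩
  · have : {s | v s = w} = ∅ := Set.eq_empty_of_forall_notMem fun s hs => hw ⟨s, hs⟩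
    simp [this]

/-! ### Effectivity of the construction -/

theorem primrec_pow : Primrec₂ ((· ^ ·) : ℕ → ℕ → ℕ) :=
  Primrec₂.unpaired'.1 Nat.Primrec.pow

theorem primrec_testBit : Primrec₂ Nat.testBit := by
  have : Primrec₂ fun x i : ℕ => decide (x / 2 ^ i % 2 = 1) :=
    (Primrec.eq.comp (Primrec.nat_mod.comp (Primrec.nat_div.comp Primrec.fst
      (primrec_pow.comp (Primrec.const 2) Primrec.snd)) (Primrec.const 2))
      (Primrec.const 1)).decide
  exact this.of_eq fun x i => Nat.testBit_eq_decide_div_mod_eq.symm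

theorem primrec_pair : Primrec₂ Nat.pair := Primrec₂.natPair

theorem primrec_find : Primrec fun a : (ℕ × ℕ) × List Bool => find a.1.1 a.1.2 a.2 :=
  Code.primrec_evaln.comp
    (((Primrec.fst.comp Primrec.fst).pair
      ((Primrec.ofNat Code).comp (Primrec.snd.comp Primrec.fst))).pair
      (Primrec.encode.comp Primrec.snd))

theorem primrec_toStr : Primrec toStr :=
  Primrec.option_getD.comp Primrec.decode (Primrec.const [])

theorem primrec_req : Primrec State.req :=
  Primrec.fst.comp (Primrec.unpair.comp Primrec.fst)

theorem primrec_guesses : Primrec₂ State.guesses :=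
  Primrec.listFilterMap (Primrec.snd.comp (Primrec.snd.comp Primrec.fst))
    (Primrec.ite (Primrec.eq.comp (Primrec.fst.comp Primrec.snd) (Primrec.snd.comp Primrec.fst))
      (Primrec.option_some.comp (Primrec.snd.comp Primrec.snd)) (Primrec.const none))

theorem primrec_reqGuesses : Primrec fun q : State => q.guesses q.req :=
  primrec_guesses.comp Primrec.id primrec_req

theorem primrec_found : Primrec₂ State.found := by
  refine Primrec.option_casesOn (Primrec.list_getElem?.comp (primrec_reqGuesses.comp Primrec.fst)
    (Primrec.nat_sub.comp (Primrec.list_length.comp (primrec_reqGuesses.comp Primrec.fst))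
      (Primrec.const 1))) (Primrec.const (some 0)) ?_
  exact primrec_find.comp (((Primrec.snd.comp Primrec.fst).pair
    (primrec_req.comp (Primrec.fst.comp Primrec.fst))).pair Primrec.snd)

theorem primrec_step : Primrec fun a : (ℕ × ℕ) × State => step a.1.1 a.1.2 a.2 := by
  have hq : Primrec fun a : (ℕ × ℕ) × State => a.2 := Primrec.snd
  have hj : Primrec fun a : (ℕ × ℕ) × State => a.2.1 := Primrec.fst.comp hq
  have hstr : Primrec fun a : (ℕ × ℕ) × State => a.2.2.1 :=
    Primrec.fst.comp (Primrec.snd.comp hq)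
  have hlog : Primrec fun a : (ℕ × ℕ) × State => a.2.2.2 :=
    Primrec.snd.comp (Primrec.snd.comp hq)
  have hlen : Primrec fun a : (ℕ × ℕ) × State => (a.2.guesses a.2.req).length :=
    Primrec.list_length.comp (primrec_reqGuesses.comp hq)
  have hK : Primrec fun a : (ℕ × ℕ) × State => a.1.2 + 1 :=
    Primrec.succ.comp (Primrec.snd.comp Primrec.fst)
  have hadv : Primrec fun a : (ℕ × ℕ) × State => ((a.2.1 + 1, a.2.2.1 ++ [false], a.2.2.2) : State) :=
    (Primrec.succ.comp hj).pair ((Primrec.list_concat.comp hstr (Primrec.const false)).pair hlog)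
  have hpush : Primrec fun a : (ℕ × ℕ) × State => a.2.2.2 ++ [(a.2.req, a.2.2.1)] :=
    Primrec.list_concat.comp hlog ((primrec_req.comp hq).pair hstr)
  have hfound : Primrec fun a : (ℕ × ℕ) × State => a.2.found a.1.1 :=
    primrec_found.comp hq (Primrec.fst.comp Primrec.fst)
  refine Primrec.ite (Primrec.nat_lt.comp hK hlen) hadv (Primrec.ite (Primrec.eq.comp hlen hK)
    (Primrec.option_casesOn hfound hq ?_) (Primrec.option_casesOn hfound hadv ?_))
  · exact (hj.comp Primrec.fst).pair ((Primrec.list_append.comp (hstr.comp Primrec.fst)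
      (primrec_toStr.comp Primrec.snd)).pair (hpush.comp Primrec.fst))
  · exact (hj.comp Primrec.fst).pair ((hstr.comp Primrec.fst).pair (hpush.comp Primrec.fst))

theorem primrec_run {α : Type*} [Primcodable α] {k : α → ℕ → ℕ} (hk : Primrec₂ k) :
    Primrec₂ fun a s => run (k a) s := by
  have h : Primrec fun a : α × ℕ × State => ((a.2.1, k a.1 a.2.2.req), a.2.2) :=
    ((Primrec.fst.comp Primrec.snd).pair (hk.comp Primrec.fst (primrec_req.comp
      (Primrec.snd.comp Primrec.snd)))).pair (Primrec.snd.comp Primrec.snd)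
  have h' : Primrec₂ fun (a : α) (b : ℕ × State) => step b.1 (k a b.2.req) b.2 :=
    primrec_step.comp h
  exact Primrec.nat_rec (Primrec.const ((0, [], []) : State)) h'

/-! ### Reading the numbers of passive guesses from the oracle -/

/-- The number of passive guesses of requirement `e` in the `m`-th construction from the oracle
`b`, read off from a block of `Nat.pair m e + 1` bits. -/
def passes (m : ℕ) (b : ℕ → Bool) (e : ℕ) : ℕ :=
  Encodable.encode ((List.range (Nat.pair m e + 1)).map fun i => b (Nat.pair e i))

/-- The encoding is injective, so distinct blocks give distinct numbers. Their order and size play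
no role. -/
theorem passes_eq_iff {m e : ℕ} {b b' : ℕ → Bool} :
    passes m b e = passes m b' e ↔ ∀ i ≤ Nat.pair m e, b (Nat.pair e i) = b' (Nat.pair e i) := by
  rw [passes, passes, Encodable.encode_inj, List.map_inj_left]
  simp

theorem primrec_passes : Primrec₂ fun (a : ℕ × ℕ) e => passes a.1 a.2.testBit e := by
  refine Primrec.encode.comp (Primrec.list_map (Primrec.list_range.comp (Primrec.succ.comp
    (primrec_pair.comp (Primrec.fst.comp Primrec.fst) Primrec.snd))) ?_)
  exact primrec_testBit.comp (Primrec.snd.comp (Primrec.fst.comp Primrec.fst))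
    (primrec_pair.comp (Primrec.snd.comp Primrec.fst) Primrec.snd)

/-- The number of oracle bits used up to stage `s` at level `n`. -/
def use (n s : ℕ) : ℕ := Nat.pair (s + n) (Nat.pair n (s + n)) + 1

theorem primrec_use : Primrec₂ use := by
  have h : Primrec fun a : ℕ × ℕ => a.2 + a.1 := Primrec.nat_add.comp Primrec.snd Primrec.fst
  exact Primrec.succ.comp (primrec_pair.comp h (primrec_pair.comp Primrec.fst h))

theorem pair_le_pair {a b c d : ℕ} (h : a ≤ c) (h' : b ≤ d) : Nat.pair a b ≤ Nat.pair c d := by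
  have h1 : Nat.pair a b ≤ Nat.pair c b := by
    rcases h.eq_or_lt with rfl | h
    · exact le_rfl
    · exact (Nat.pair_lt_pair_left b h).le
  have h2 : Nat.pair c b ≤ Nat.pair c d := by
    rcases h'.eq_or_lt with rfl | h'
    · exact le_rfl
    · exact (Nat.pair_lt_pair_right c h').le
  exact h1.trans h2

theorem passes_num (X : Cantor) {m n s i : ℕ} (hm : m ≤ n) (hi : i ≤ s + n) :
    passes m X i = passes m (num X (use n s)).testBit i := by
  rw [passes_eq_iff]
  intro j hj
  exact (testBit_num X (Nat.lt_succ_of_le (pair_le_pair hi (hj.trans (pair_le_pair hm hi))))).symm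

/-- `Active` for the requirement and the construction coded by `n`. -/
def LevelActive (n s : ℕ) (b : ℕ → Bool) : Prop :=
  Active (passes n.unpair.1 b) n.unpair.2 s

/-- `Refuted` for the requirement and the construction coded by `n`. -/
def LevelRefuted (n s : ℕ) (b : ℕ → Bool) : Prop :=
  Refuted (passes n.unpair.1 b) n.unpair.2 s

theorem levelActive_num (n s : ℕ) (X : Cantor) :
    LevelActive n s X ↔ LevelActive n s (num X (use n s)).testBit :=
  active_congr fun _ hi => passes_num X (Nat.unpair_left_le n)
    (hi.trans (Nat.add_le_add_left (Nat.unpair_right_le n) s))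

theorem levelRefuted_num (n s : ℕ) (X : Cantor) :
    LevelRefuted n s X ↔ LevelRefuted n s (num X (use n s)).testBit :=
  refuted_congr fun _ hi => passes_num X (Nat.unpair_left_le n)
    (hi.trans (Nat.add_le_add_left (Nat.unpair_right_le n) s))

theorem primrec_levelRun : Primrec fun a : (ℕ × ℕ) × ℕ =>
    run (passes a.1.1.unpair.1 a.2.testBit) a.1.2 := by
  have h : Primrec₂ fun (a : (ℕ × ℕ) × ℕ) e => passes a.1.1.unpair.1 a.2.testBit e :=
    primrec_passes.comp (((Primrec.fst.comp (Primrec.unpair.comp (Primrec.fst.comp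
      Primrec.fst))).pair Primrec.snd).comp Primrec.fst) Primrec.snd
  exact (primrec_run h).comp Primrec.id (Primrec.snd.comp Primrec.fst)

theorem primrec_levelGuess : Primrec fun a : (ℕ × ℕ) × ℕ =>
    ((run (passes a.1.1.unpair.1 a.2.testBit) a.1.2).guesses
      a.1.1.unpair.2)[passes a.1.1.unpair.1 a.2.testBit a.1.1.unpair.2]? := by
  have hn : Primrec fun a : (ℕ × ℕ) × ℕ => a.1.1.unpair :=
    Primrec.unpair.comp (Primrec.fst.comp Primrec.fst)
  exact Primrec.list_getElem?.comp
    (primrec_guesses.comp primrec_levelRun (Primrec.snd.comp hn))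
    (primrec_passes.comp ((Primrec.fst.comp hn).pair Primrec.snd) (Primrec.snd.comp hn))

theorem primrecPred_levelActive :
    PrimrecPred fun a : (ℕ × ℕ) × ℕ => LevelActive a.1.1 a.1.2 a.2.testBit := by
  refine (PrimrecPred.of_eq (p := fun a => Option.isSome _ = true) (Primrec.eq.comp
    (Primrec.option_isSome.comp primrec_levelGuess) (Primrec.const true))) fun a => ?_
  rw [Option.isSome_iff_exists]
  rfl

theorem primrecPred_levelRefuted :
    PrimrecPred fun a : (ℕ × ℕ) × ℕ => LevelRefuted a.1.1 a.1.2 a.2.testBit := by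
  have hf : Primrec₂ fun (a : (ℕ × ℕ) × ℕ) p => find a.1.2 a.1.1.unpair.2 p :=
    primrec_find.comp ((((Primrec.snd.comp Primrec.fst).pair (Primrec.snd.comp
      (Primrec.unpair.comp (Primrec.fst.comp Primrec.fst)))).comp Primrec.fst).pair Primrec.snd)
  refine (PrimrecPred.of_eq (p := fun a => Option.isSome _ = true) (Primrec.eq.comp
    (Primrec.option_isSome.comp (Primrec.option_bind primrec_levelGuess hf))
      (Primrec.const true))) fun a => ?_
  rw [Option.isSome_bind, Option.any_eq_true]
  rfl

theorem primrec_count {α : Type*} [Primcodable α] {p : α → ℕ → Prop} [∀ a, DecidablePred (p a)]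
    (hp : PrimrecRel p) : Primrec₂ fun a n => Nat.count (p a) n := by
  have h' : Primrec₂ fun (a : α) (b : ℕ × ℕ) => b.2 + if p a b.1 then 1 else 0 :=
    Primrec.nat_add.comp (Primrec.snd.comp Primrec.snd)
      (Primrec.ite (hp.comp Primrec.fst (Primrec.fst.comp Primrec.snd)) (Primrec.const 1)
        (Primrec.const 0))
  have h : Primrec₂ fun (a : α) n => Nat.rec (motive := fun _ => ℕ) 0
      (fun i c => c + if p a i then 1 else 0) n :=
    Primrec.nat_rec (Primrec.const 0) h'
  refine h.of_eq fun a n => ?_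
  induction n with
  | zero => simp
  | succ n ih => rw [Nat.count_succ, ← ih]

/-! ### The Demuth test -/

open Classical in
/-- The version of level `n` of the test that is current at stage `s`: the measure of the refuted
oracles in units of `2 ^ (-(n + 1))`, rounded down. -/
noncomputable def version (n s : ℕ) : ℕ :=
  2 ^ (n + 1) * Nat.count (fun x => LevelRefuted n s x.testBit) (2 ^ use n s) / 2 ^ use n s

theorem primrec_version : Primrec₂ version := by
  classical
  have h2 : Primrec fun a : ℕ × ℕ => 2 ^ use a.1 a.2 :=
    primrec_pow.comp (Primrec.const 2) primrec_use
  have hp : PrimrecRel fun (a : ℕ × ℕ) x => LevelRefuted a.1 a.2 (Nat.testBit x) :=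
    primrecPred_levelRefuted
  exact Primrec.nat_div.comp (Primrec.nat_mul.comp (primrec_pow.comp (Primrec.const 2)
    (Primrec.succ.comp Primrec.fst)) ((primrec_count hp).comp Primrec.id h2)) h2

/-- The oracles that wait at level `n` at some stage with current version `w`. -/
def versionSet (n w : ℕ) : Set Cantor :=
  ⋃ s ∈ {s | version n s = w}, {X | LevelActive n s X} \ {X | LevelRefuted n s X}

theorem primrec_bits : Primrec₂ fun x u : ℕ => (List.range u).map x.testBit := by
  have h : Primrec₂ fun (a : ℕ × ℕ) i => a.1.testBit i :=
    primrec_testBit.comp (Primrec.fst.comp Primrec.fst) Primrec.snd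
  exact Primrec.list_map (Primrec.list_range.comp Primrec.snd) h

/-- The versions of all levels are uniformly effectively open. -/
theorem exists_index : ∃ f : ℕ → ℕ → ℕ, Computable₂ f ∧ ∀ n w, effOpen (f n w) = versionSet n w := by
  classical
  -- A witness `i` codes a stage and a number whose binary digits are the oracle bits used. `a`
  -- holds the coded pair of level and version, and the code of a string.
  let P : ℕ × ℕ → ℕ → Prop := fun a i =>
    version a.1.unpair.1 i.unpair.1 = a.1.unpair.2 ∧
    (LevelActive a.1.unpair.1 i.unpair.1 (Nat.testBit i.unpair.2) ∧
      ¬ LevelRefuted a.1.unpair.1 i.unpair.1 (Nat.testBit i.unpair.2)) ∧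
    Encodable.encode ((List.range (use a.1.unpair.1 i.unpair.1)).map (Nat.testBit i.unpair.2)) = a.2
  have hP : PrimrecRel P := by
    have ha : Primrec fun a : (ℕ × ℕ) × ℕ => a.1.1.unpair :=
      Primrec.unpair.comp (Primrec.fst.comp Primrec.fst)
    have hi : Primrec fun a : (ℕ × ℕ) × ℕ => a.2.unpair := Primrec.unpair.comp Primrec.snd
    have hn := Primrec.fst.comp ha
    have hs := Primrec.fst.comp hi
    have hx := Primrec.snd.comp hi
    exact (Primrec.eq.comp (primrec_version.comp hn hs) (Primrec.snd.comp ha)).and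
      (((primrecPred_levelActive.comp ((hn.pair hs).pair hx)).and
        (primrecPred_levelRefuted.comp ((hn.pair hs).pair hx)).not).and
        (Primrec.eq.comp (Primrec.encode.comp (primrec_bits.comp hx (primrec_use.comp hn hs)))
          (Primrec.snd.comp Primrec.fst)))
  have hpart : Partrec fun a : ℕ × ℕ => Nat.rfindOpt fun i => if P a i then some 0 else none :=
    Partrec.rfindOpt (Primrec.ite hP (Primrec.const (some 0)) (Primrec.const none)).to_comp
  obtain ⟨c, hc⟩ := Code.exists_code.1 (hpart.comp Computable.unpair)
  -- The s-m-n theorem turns the uniform enumeration into a computable index.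
  refine ⟨fun n w => Encodable.encode (c.curry (Nat.pair n w)),
    (Primrec.encode.comp (Code.primrec₂_curry.comp (Primrec.const c)
      (primrec_pair.comp Primrec.fst Primrec.snd))).to_comp, fun n w => ?_⟩
  have hmem : ∀ σ : List Bool, σ ∈ ceSet (Encodable.encode (c.curry (Nat.pair n w))) ↔
      ∃ s x, version n s = w ∧ (LevelActive n s (Nat.testBit x) ∧
        ¬ LevelRefuted n s (Nat.testBit x)) ∧ (List.range (use n s)).map x.testBit = σ := by
    intro σ
    have h1 : c.eval (Nat.pair (Nat.pair n w) (Encodable.encode σ)) =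
        Nat.rfindOpt fun i => if P (Nat.pair n w, Encodable.encode σ) i then some 0 else none := by
      have := congrFun hc (Nat.pair (Nat.pair n w) (Encodable.encode σ))
      simpa [Part.map_id'] using this
    rw [ceSet, Set.mem_ofPred_eq, Denumerable.ofNat_encode, Code.eval_curry, h1, Nat.rfindOpt_dom]
    constructor
    · rintro ⟨i, a, hi⟩
      have hPi : P (Nat.pair n w, Encodable.encode σ) i := by
        by_contra hPi
        simp [hPi] at hi
      simp only [P, Nat.unpair_pair, Encodable.encode_inj] at hPi
      exact ⟨_, _, hPi⟩
    · rintro ⟨s, x, h⟩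
      refine ⟨Nat.pair s x, 0, ?_⟩
      have hPi : P (Nat.pair n w, Encodable.encode σ) (Nat.pair s x) := by
        simpa only [P, Nat.unpair_pair, Encodable.encode_inj] using h
      simp [hPi]
  ext X
  simp only [effOpen, openOf, versionSet, Set.mem_iUnion, exists_prop, hmem, Set.mem_ofPred_eq,
    Set.mem_sdiff]
  constructor
  · rintro ⟨σ, ⟨s, x, h1, h2, rfl⟩, hX⟩
    have hx : ∀ i < use n s, X i = x.testBit i := fun i hi => by
      have := hX i (by simpa using hi)
      rwa [List.getElem_map, List.getElem_range] at this
    have hpas : ∀ i ≤ s + n.unpair.2, passes n.unpair.1 X i = passes n.unpair.1 x.testBit i := by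
      intro i hi
      have hi : i ≤ s + n := hi.trans (Nat.add_le_add_left (Nat.unpair_right_le n) s)
      rw [passes_eq_iff]
      exact fun j hj => hx _ (Nat.lt_succ_of_le (pair_le_pair hi (hj.trans (pair_le_pair
        (Nat.unpair_left_le n) hi))))
    exact ⟨s, h1, (active_congr hpas).2 h2.1, fun h => h2.2 ((refuted_congr hpas).1 h)⟩
  · rintro ⟨s, h1, h2, h3⟩
    refine ⟨_, ⟨s, num X (use n s), h1, ⟨(levelActive_num n s X).1 h2,
      fun h => h3 ((levelRefuted_num n s X).2 h)⟩, rfl⟩, ?_⟩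
    intro i hi
    have hi' : i < use n s := by simpa using hi
    simp [testBit_num X hi']

theorem setOf_levelActive (n s : ℕ) : {X : Cantor | LevelActive n s X} =
    {X | LevelActive n s (num X (use n s)).testBit} := by
  ext X
  exact levelActive_num n s X

theorem setOf_levelRefuted (n s : ℕ) : {X : Cantor | LevelRefuted n s X} =
    {X | LevelRefuted n s (num X (use n s)).testBit} := by
  ext X
  exact levelRefuted_num n s X

theorem measurableSet_levelActive (n s : ℕ) : MeasurableSet {X : Cantor | LevelActive n s X} := by
  rw [setOf_levelActive]
  exact measurableSet_num (use n s) fun x => LevelActive n s x.testBit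

theorem measurableSet_levelRefuted (n s : ℕ) :
    MeasurableSet {X : Cantor | LevelRefuted n s X} := by
  rw [setOf_levelRefuted]
  exact measurableSet_num (use n s) fun x => LevelRefuted n s x.testBit

/-- The bits outside the block of requirement `e` fix all the other numbers, hence leave at most one
waiting value for `e` itself and so one block of `n + 1` bits. -/
theorem lebesgue_waiting_le (n s : ℕ) :
    lebesgue ({X | LevelActive n s X} \ {X | LevelRefuted n s X}) ≤ (2 : ENNReal)⁻¹ ^ (n + 1) := by
  have hinj : Function.Injective (Nat.pair n.unpair.2) := fun i j h => (Nat.pair_eq_pair.1 h).2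
  have h := lebesgue_le_of_determined 
    ((measurableSet_levelActive n s).diff (measurableSet_levelRefuted n s))
    ((Finset.range (n + 1)).image (Nat.pair n.unpair.2)) ?_
  · rwa [Finset.card_image_of_injective _ hinj, Finset.card_range] at h
  rintro X ⟨hX, hX'⟩ Y ⟨hY, hY'⟩ hXY
  have hoff : ∀ i, i ≠ n.unpair.2 → passes n.unpair.1 X i = passes n.unpair.1 Y i := by
    intro i hi
    rw [passes_eq_iff]
    refine fun j _ => hXY _ fun hmem => ?_
    obtain ⟨j', -, hj'⟩ := Finset.mem_image.1 hmem
    exact hi (Nat.pair_eq_pair.1 hj').1.symm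
  rcases lt_trichotomy (passes n.unpair.1 X n.unpair.2) (passes n.unpair.1 Y n.unpair.2) with
    hlt | heq | hlt
  · exact absurd hY (not_active_of_waiting hoff hlt hX hX')
  · funext i
    by_cases hi : i ∈ (Finset.range (n + 1)).image (Nat.pair n.unpair.2)
    · obtain ⟨j, hj, rfl⟩ := Finset.mem_image.1 hi
      rw [passes_eq_iff, Nat.pair_unpair] at heq
      exact heq j (Nat.lt_succ_iff.1 (Finset.mem_range.1 hj))
    · exact hXY i hi
  · exact absurd hX (not_active_of_waiting (fun i hi => (hoff i hi).symm) hlt hY hY')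

theorem monotone_levelActive (n : ℕ) : Monotone fun s => {X : Cantor | LevelActive n s X} :=
  fun _ _ h _ hX => Active.mono hX h

theorem monotone_levelRefuted (n : ℕ) : Monotone fun s => {X : Cantor | LevelRefuted n s X} :=
  fun _ _ h _ hX => Refuted.mono hX h

theorem version_eq_floor (n s : ℕ) :
    version n s = ⌊(2 : ℝ) ^ (n + 1) * lebesgue.real {X | LevelRefuted n s X}⌋₊ := by
  classical
  have h : lebesgue.real {X | LevelRefuted n s X} =
      Nat.count (fun x => LevelRefuted n s x.testBit) (2 ^ use n s) / (2 : ℝ) ^ use n s := by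
    rw [setOf_levelRefuted, measureReal_def, lebesgue_setOf_num (use n s)
      fun x => LevelRefuted n s x.testBit]
    simp [div_eq_mul_inv]
  rw [h, version, ← mul_div_assoc, ← Nat.floor_div_eq_div (K := ℝ)]
  push_cast
  congr! 4

theorem version_mono (n : ℕ) : Monotone (version n) := by
  intro s t h
  rw [version_eq_floor, version_eq_floor]
  have := measureReal_mono (μ := lebesgue) (monotone_levelRefuted n h) (measure_ne_top _ _)
  gcongr

theorem version_le (n s : ℕ) : version n s ≤ 2 ^ (n + 1) := by
  rw [version_eq_floor]
  refine Nat.floor_le_of_le ?_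
  push_cast
  exact mul_le_of_le_one_right (by positivity) measureReal_le_one

/-- Equal integer parts put the rescaled measures within 1 of each other. -/
theorem lebesgue_refuted_le {n s t : ℕ} (h : version n s = version n t) :
    lebesgue {X | LevelRefuted n t X} ≤
      lebesgue {X | LevelRefuted n s X} + (2 : ENNReal)⁻¹ ^ (n + 1) := by
  have h1 : (2 : ℝ) ^ (n + 1) * lebesgue.real {X | LevelRefuted n t X} ≤
      2 ^ (n + 1) * lebesgue.real {X | LevelRefuted n s X} + 1 := by
    refine (Nat.lt_floor_add_one _).le.trans ?_
    rw [← version_eq_floor, ← h, version_eq_floor]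
    gcongr
    exact Nat.floor_le (by positivity)
  have h2 : lebesgue.real {X | LevelRefuted n t X} ≤
      lebesgue.real {X | LevelRefuted n s X} + (2 : ℝ)⁻¹ ^ (n + 1) := by
    have hp : (0 : ℝ) < 2 ^ (n + 1) := by positivity
    refine le_of_mul_le_mul_left (h1.trans_eq ?_) hp
    rw [mul_add, inv_pow, mul_inv_cancel₀ hp.ne']
  have h3 : (2 : ENNReal)⁻¹ ^ (n + 1) ≠ ⊤ := by simp
  rw [← ENNReal.toReal_le_toReal (measure_ne_top _ _) (by simp),
    ENNReal.toReal_add (measure_ne_top _ _) h3]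
  simpa [measureReal_def] using h2

theorem lebesgue_versionSet_le (n w : ℕ) : lebesgue (versionSet n w) ≤ (2 : ENNReal)⁻¹ ^ n := by
  refine (measure_version_le lebesgue (monotone_levelActive n) (monotone_levelRefuted n)
    (measurableSet_levelRefuted n) (lebesgue_waiting_le n) (version n)
    (fun _ _ _ h => lebesgue_refuted_le h) w).trans_eq ?_
  rw [pow_succ, ← mul_add, ENNReal.inv_two_add_inv_two, mul_one]

theorem version_eventually (n : ℕ) : ∃ w, ∀ᶠ s in Filter.atTop, version n s = w := by
  by_contra! hc
  have : ∀ d, ∃ s, d ≤ version n s := by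
    intro d
    induction d with
    | zero => exact ⟨0, Nat.zero_le _⟩
    | succ d ih =>
      obtain ⟨s, hs⟩ := ih
      obtain ⟨t, ht, hne⟩ := Filter.frequently_atTop.1 (hc (version n s)) s
      have := version_mono n ht
      exact ⟨t, by omega⟩
  obtain ⟨s, hs⟩ := this (2 ^ (n + 1) + 1)
  have := version_le n s
  omega

/-- Each change strictly increases `v`, so `v` is injective on the stages of change, with values
below `b`. -/
theorem encard_changes_le {v : ℕ → ℕ} (hv : Monotone v) {b : ℕ} (hb : ∀ s, v s ≤ b) :
    {s | v s ≠ v (s + 1)}.encard ≤ b := by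
  have hlt : ∀ s ∈ {s | v s ≠ v (s + 1)}, v s < v (s + 1) := fun s hs =>
    lt_of_le_of_ne (hv (Nat.le_succ s)) hs
  have hmaps : Set.MapsTo v {s | v s ≠ v (s + 1)} (Finset.range b) := fun s hs => by
    have := hlt s hs
    have := hb (s + 1)
    simp only [Finset.coe_range, Set.mem_Iio]
    omega
  have hinj : Set.InjOn v {s | v s ≠ v (s + 1)} := by
    intro s hs t ht hst
    have h1 := hlt s hs
    have h2 := hlt t ht
    rcases lt_trichotomy s t with h | h | h
    · have := hv (Nat.succ_le_of_lt h)
      simp only [Nat.succ_eq_add_one] at this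
      omega
    · exact h
    · have := hv (Nat.succ_le_of_lt h)
      simp only [Nat.succ_eq_add_one] at this
      omega
  refine (Set.encard_le_encard_of_injOn hmaps hinj).trans ?_
  rw [Set.encard_coe_eq_coe_finsetCard, Finset.card_range]

/-- Some Demuth test captures every oracle that waits forever at some level. -/
theorem exists_demuthTest : ∃ g, IsDemuthTest g ∧ ∀ n (X : Cantor),
    (∃ s, LevelActive n s X) → (∀ s, ¬ LevelRefuted n s X) → X ∈ effOpen (g n) := by
  obtain ⟨f, hf, hfe⟩ := exists_index
  choose w hw using version_eventually
  refine ⟨fun n => f n (w n), ⟨⟨fun n s => f n (version n s), fun n => 2 ^ (n + 1),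
    hf.comp Computable.fst primrec_version.to_comp,
    (primrec_pow.comp (Primrec.const 2) Primrec.succ).to_comp,
    fun n => (hw n).mono fun s hs => congrArg (f n) hs, fun n => ?_⟩, fun n => ?_⟩, fun n X hA hR => ?_⟩
  · have h := encard_changes_le (version_mono n) (version_le n)
    have hsub : {s | f n (version n s) ≠ f n (version n (s + 1))} ⊆
        {s | version n s ≠ version n (s + 1)} := fun s hs hs' => hs (congrArg (f n) hs')
    exact (Set.encard_le_encard hsub).trans h
  · rw [hfe]
    exact lebesgue_versionSet_le n (w n)
  · rw [hfe]
    obtain ⟨s, hs⟩ := hA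
    -- An oracle waiting forever still waits at a stage where the final version is current.
    obtain ⟨t, ht, hst⟩ := ((hw n).and (Filter.eventually_ge_atTop s)).exists
    exact Set.mem_biUnion (x := t) ht ⟨monotone_levelActive n hst hs, hR t⟩

/-! ### Turing reducibility to the oracle -/

section Reducibility

variable {O : Set (ℕ →. ℕ)}

theorem recursiveIn_of_primrec {f : ℕ → ℕ} (hf : Primrec f) :
    Nat.RecursiveIn O fun n => Part.some (f n) :=
  (Primrec.nat_iff.1 hf).recursiveIn

theorem recursiveIn_pair {f g : ℕ → ℕ} (hf : Nat.RecursiveIn O fun n => Part.some (f n))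
    (hg : Nat.RecursiveIn O fun n => Part.some (g n)) :
    Nat.RecursiveIn O fun n => Part.some (Nat.pair (f n) (g n)) :=
  (hf.pair hg).of_eq fun n => by simp [Seq.seq]

theorem recursiveIn_comp {f g : ℕ → ℕ} (hf : Nat.RecursiveIn O fun n => Part.some (f n))
    (hg : Nat.RecursiveIn O fun n => Part.some (g n)) :
    Nat.RecursiveIn O fun n => Part.some (f (g n)) :=
  (hf.comp hg).of_eq fun n => by simp

theorem recursiveIn_num (X : Cantor) :
    Nat.RecursiveIn {toFun X} fun u => Part.some (num X u) := by
  have hunp : Primrec fun n : ℕ => n.unpair.2.unpair := Primrec.unpair.comp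
    (Primrec.snd.comp Primrec.unpair)
  have hX : Nat.RecursiveIn {toFun X} fun n => Part.some ((X n).toNat) := .oracle _ rfl
  have h1 := recursiveIn_comp hX (recursiveIn_of_primrec (Primrec.fst.comp hunp))
  -- The input pairs the argument of the recursion step, itself coding `(a, (i, x))`, with the bit
  -- `X i`.
  have h2 : Primrec fun n : ℕ => 2 ^ n.unpair.1.unpair.2.unpair.1 * n.unpair.2 +
      n.unpair.1.unpair.2.unpair.2 := by
    have h3 : Primrec fun n : ℕ => n.unpair.1.unpair.2.unpair :=
      hunp.comp (Primrec.fst.comp Primrec.unpair)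
    exact Primrec.nat_add.comp (Primrec.nat_mul.comp (primrec_pow.comp (Primrec.const 2)
      (Primrec.fst.comp h3)) (Primrec.snd.comp Primrec.unpair)) (Primrec.snd.comp h3)
  have h3 := recursiveIn_comp (recursiveIn_of_primrec h2)
    (recursiveIn_pair (recursiveIn_of_primrec Primrec.id) h1)
  have h4 := (recursiveIn_of_primrec (O := {toFun X}) (Primrec.const 0)).prec h3
  refine (h4.comp (recursiveIn_of_primrec
    (primrec_pair.comp (Primrec.const 0) Primrec.id))).of_eq fun u => ?_
  simp only [id, Part.bind_eq_bind, Part.bind_some, Nat.unpair_pair]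
  induction u with
  | zero => rfl
  | succ u ih =>
    simp only [ih, Part.bind_some]
    rfl

/-- A sequence whose bits are listed by a primitive recursive procedure with oracle `X` is
computable in `X`. -/
theorem computes_of_primrec {X Y : Cantor} {t : ℕ → ℕ → List Bool} (ht : Primrec₂ t) {u : ℕ → ℕ}
    (hu : Primrec u) (hY : ∀ s i b, (t s (num X (u s)))[i]? = some b → Y i = b)
    (hlen : ∀ i, ∃ s, i < (t s (num X (u s))).length) : Computes X Y := by
  rw [Computes, TuringReducible, RecursiveIn.iff_nat]
  have hsx : Nat.RecursiveIn {toFun X} fun a =>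
      Part.some (Nat.pair a (num X (u a.unpair.2))) :=
    recursiveIn_pair (recursiveIn_of_primrec Primrec.id) (recursiveIn_comp (recursiveIn_num X)
      (recursiveIn_of_primrec (hu.comp (Primrec.snd.comp Primrec.unpair))))
  have hd : Primrec fun a : ℕ => a.unpair.1.unpair :=
    Primrec.unpair.comp (Primrec.fst.comp Primrec.unpair)
  have ht' : Primrec fun a : ℕ => t a.unpair.1.unpair.2 a.unpair.2 :=
    ht.comp (Primrec.snd.comp hd) (Primrec.snd.comp Primrec.unpair)
  -- The value 0 signals success to unbounded search, which finds a stage listing the wanted bit.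
  have hlt : Primrec fun a : ℕ =>
      if a.unpair.1.unpair.1 < (t a.unpair.1.unpair.2 a.unpair.2).length then 0 else 1 :=
    Primrec.ite (Primrec.nat_lt.comp (Primrec.fst.comp hd) (Primrec.list_length.comp ht'))
      (Primrec.const 0) (Primrec.const 1)
  have hval : Primrec fun a : ℕ =>
      ((t a.unpair.1.unpair.2 a.unpair.2)[a.unpair.1.unpair.1]?.getD false).toNat :=
    (Primrec.dom_finite Bool.toNat).comp (Primrec.option_getD.comp
      (Primrec.list_getElem?.comp ht' (Primrec.fst.comp hd)) (Primrec.const false))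
  have hfind := (recursiveIn_comp (recursiveIn_of_primrec hlt) hsx).rfind
  have hv := recursiveIn_comp (recursiveIn_of_primrec hval) hsx
  have hid : Nat.RecursiveIn {toFun X} fun a => Part.some a :=
    recursiveIn_of_primrec Primrec.id
  refine (hv.comp (hid.pair hfind)).of_eq fun i => ?_
  simp only [Nat.unpair_pair, Part.map_eq_map, Part.map_some, Part.bind_eq_bind]
  have hdom : ∃ s, s ∈ Nat.rfind fun s => Part.some (decide
      ((if i < (t s (num X (u s))).length then 0 else 1) = 0)) := by
    obtain ⟨s, hs⟩ := hlen i
    obtain ⟨s', hs', -⟩ := Nat.rfind_min' (p := fun s => decide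
      ((if i < (t s (num X (u s))).length then 0 else 1) = 0)) (m := s) (by simp [hs])
    exact ⟨s', hs'⟩
  obtain ⟨s, hs⟩ := hdom
  have hs' := Nat.rfind_spec hs
  rw [Part.eq_some_iff.2 hs]
  have hlt' : i < (t s (num X (u s))).length := by
    by_contra hc
    simp [hc] at hs'
  have hget : (t s (num X (u s)))[i]? = some ((t s (num X (u s)))[i]) :=
    List.getElem?_eq_getElem hlt'
  simp [Seq.seq, hget, toFun, hY s i _ hget]

end Reducibility

/-! ### Genericity and conclusion -/

theorem strCylinder_anti {σ τ : List Bool} (h : σ <+: τ) : strCylinder τ ⊆ strCylinder σ := by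
  intro X hX i hi
  rw [h.getElem hi]
  exact hX i _

theorem isOpen_strCylinder (σ : List Bool) : IsOpen (strCylinder σ) := by
  have : strCylinder σ = ⋂ i : Fin σ.length, {X : Cantor | X i = σ[i]} := by
    ext X
    simp only [strCylinder, Set.mem_iInter, Set.mem_ofPred_eq]
    exact ⟨fun h i => h i i.2, fun h i hi => h ⟨i, hi⟩⟩
  rw [this]
  refine isOpen_iInter_of_finite fun i => ?_
  exact (isOpen_discrete ({σ[i]} : Set Bool)).preimage
    (continuous_apply (A := fun _ : ℕ => Bool) (i : ℕ))

theorem prefix_bits {σ : List Bool} {X : Cantor} (hX : X ∈ strCylinder σ) {N : ℕ}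
    (hN : σ.length ≤ N) : σ = ((List.range N).map X).take σ.length := by
  refine List.ext_getElem (by simpa using hN) fun i h1 h2 => ?_
  simp [hX i h1]

theorem toStr_encode (σ : List Bool) : toStr (Encodable.encode σ) = σ := by
  simp [toStr]

theorem mem_ceSet_iff {d : ℕ} {σ : List Bool} : σ ∈ ceSet d ↔ ∃ s, (find s d σ).isSome := by
  rw [ceSet, Set.mem_ofPred_eq, Part.dom_iff_mem]
  simp only [find, Option.isSome_iff_exists, Code.evaln_complete, Option.mem_def]
  exact exists_comm

/-- Some partial computable function finds, for a given string, an extension in a given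
effectively open set if there is one. -/
theorem exists_extension_finder (d : ℕ) : ∃ e : ℕ, ∀ p : List Bool,
    (∀ v ∈ (Denumerable.ofNat Code e).eval (Encodable.encode p),
      strCylinder (p ++ toStr v) ⊆ effOpen d) ∧
    ((strCylinder p ∩ effOpen d).Nonempty →
      ((Denumerable.ofNat Code e).eval (Encodable.encode p)).Dom) := by
  -- `i` codes a stage, a continuation of the string and a length. Truncating to that length is
  -- needed because the enumerated string may be shorter than the extended one.
  let F : ℕ → ℕ → Option ℕ := fun a i =>
    find i.unpair.1 d ((toStr a ++ toStr i.unpair.2.unpair.1).take i.unpair.2.unpair.2)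
  have hF : Primrec₂ F := by
    have h1 : Primrec fun a : ℕ × ℕ => a.2.unpair := Primrec.unpair.comp Primrec.snd
    have h2 : Primrec fun a : ℕ × ℕ => a.2.unpair.2.unpair :=
      Primrec.unpair.comp (Primrec.snd.comp h1)
    exact primrec_find.comp (((Primrec.fst.comp h1).pair (Primrec.const d)).pair
      (Primrec.list_take.comp (Primrec.snd.comp h2) (Primrec.list_append.comp
        (primrec_toStr.comp Primrec.fst) (primrec_toStr.comp (Primrec.fst.comp h2)))))
  have hG : Primrec₂ fun a i => (F a i).map fun _ => i.unpair.2.unpair.1 := by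
    have h : Primrec₂ fun (a : ℕ × ℕ) (_ : ℕ) => a.2.unpair.2.unpair.1 :=
      Primrec.fst.comp (Primrec.unpair.comp (Primrec.snd.comp
        (Primrec.unpair.comp (Primrec.snd.comp Primrec.fst))))
    exact Primrec.option_map hF h
  obtain ⟨c, hc⟩ := Code.exists_code.1 (Partrec.nat_iff.1 (Partrec.rfindOpt hG.to_comp))
  refine ⟨Encodable.encode c, fun p => ?_⟩
  rw [Denumerable.ofNat_encode, hc]
  constructor
  · intro v hv X hX
    obtain ⟨i, hi⟩ := Nat.rfindOpt_spec hv
    obtain ⟨y, hy, rfl⟩ := Option.map_eq_some_iff.1 hi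
    simp only [F, toStr_encode] at hy
    refine Set.mem_biUnion (mem_ceSet_iff.2 ⟨_, Option.isSome_iff_exists.2 ⟨y, hy⟩⟩) ?_
    exact strCylinder_anti (List.take_prefix _ _) hX
  · rintro ⟨X, hX, hX'⟩
    obtain ⟨σ, hσ, hXσ⟩ := Set.mem_iUnion₂.1 hX'
    obtain ⟨s, hs⟩ := mem_ceSet_iff.1 hσ
    obtain ⟨y, hy⟩ := Option.isSome_iff_exists.1 hs
    have h1 := prefix_bits hX (le_max_left p.length σ.length)
    have h2 := prefix_bits hXσ (le_max_right p.length σ.length)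
    set w := (List.range (max p.length σ.length)).map X
    have h3 : p ++ w.drop p.length = w := by
      nth_rewrite 1 [h1]
      exact List.take_append_drop _ _
    refine Nat.rfindOpt_dom.2 ⟨Nat.pair s (Nat.pair (Encodable.encode (w.drop p.length)) σ.length),
      Encodable.encode (w.drop p.length), ?_⟩
    simp only [F, Nat.unpair_pair, toStr_encode, h3, ← h2, hy]
    rfl

/-- If no requirement waits forever, the constructed sequence is `1`-generic. -/
theorem oneGeneric_of_run {k : ℕ → ℕ} (H : ∀ e s, Active k e s → ∃ t, Refuted k e t) {Y : Cantor}
    (hY : ∀ s, Y ∈ strCylinder (run k s).2.1) : OneGeneric Y := by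
  intro U hU
  obtain ⟨d, rfl⟩ := (effectivelyOpen_iff U).1 hU
  obtain ⟨e, he⟩ := exists_extension_finder d
  obtain ⟨s, p, hp, hv⟩ := requirement_met H e
  by_cases hdom : ((Denumerable.ofNat Code e).eval (Encodable.encode p)).Dom
  · obtain ⟨v, hv'⟩ := Part.dom_iff_mem.1 hdom
    exact Or.inl ((he p).1 v hv' (strCylinder_anti (hv v hv') (hY s)))
  · right
    intro hcl
    obtain ⟨Z, hZ⟩ := mem_closure_iff.1 hcl _ (isOpen_strCylinder p) (strCylinder_anti hp (hY s))
    exact hdom ((he p).2 ⟨Z, hZ⟩)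

/-- Every Demuth random sequence computes a `1`-generic sequence. -/
theorem exists_oneGeneric_computes {X : Cantor} (hX : DemuthRandom X) :
    ∃ Y : Cantor, OneGeneric Y ∧ Computes X Y := by
  obtain ⟨g, hg, hgX⟩ := exists_demuthTest
  obtain ⟨m, hm⟩ := (hX g hg).bddAbove
  have H : ∀ e s, Active (passes (m + 1) X) e s → ∃ t, Refuted (passes (m + 1) X) e t := by
    intro e s hs
    by_contra! hc
    have hmem : X ∈ effOpen (g (Nat.pair (m + 1) e)) := by
      refine hgX _ X ⟨s, ?_⟩ fun t => ?_
      · rwa [LevelActive, Nat.unpair_pair]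
      · rw [LevelRefuted, Nat.unpair_pair]
        exact hc t
    have h1 := hm hmem
    have h2 := Nat.left_le_pair (m + 1) e
    omega
  choose S hS using exists_length_gt H
  have hget : ∀ s i b, (run (passes (m + 1) X) s).2.1[i]? = some b →
      (run (passes (m + 1) X) (S i)).2.1[i]'(hS i) = b := by
    intro s i b hb
    have h1 := getElem?_of_prefix (run_prefix _ (le_max_left s (S i))) hb
    have h2 := getElem?_of_prefix (run_prefix _ (le_max_right s (S i)))
      (List.getElem?_eq_getElem (hS i))
    exact Option.some_injective _ (h2.symm.trans h1)
  refine ⟨fun i => (run (passes (m + 1) X) (S i)).2.1[i]'(hS i),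
    oneGeneric_of_run H fun s i hi => hget s i _ (List.getElem?_eq_getElem hi), ?_⟩
  have hrun : ∀ s, run (passes (m + 1) X) s =
      run (passes (m + 1) (num X (use (m + 1) s)).testBit) s := fun s =>
    run_congr fun e he => passes_num X le_rfl (by omega)
  have ht : Primrec₂ fun s x : ℕ => (run (passes (m + 1) x.testBit) s).2.1 := by
    have h1 : Primrec₂ fun (x : ℕ) e => passes (m + 1) x.testBit e :=
      primrec_passes.comp ((Primrec.const (m + 1)).pair Primrec.fst) Primrec.snd
    exact Primrec.fst.comp (Primrec.snd.comp ((primrec_run h1).comp Primrec.snd Primrec.fst))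
  refine computes_of_primrec ht (primrec_use.comp (Primrec.const (m + 1)) Primrec.id)
    (fun s i b hb => hget s i b ?_) fun i => ⟨S i, ?_⟩
  · rwa [hrun s]
  · rw [id, ← hrun]
    exact hS i

end DemuthGeneric

theorem mainTheorem2 (X : DemuthGeneric.Cantor) (hX : DemuthGeneric.DemuthRandom X) :
    ∃ Y : DemuthGeneric.Cantor, DemuthGeneric.OneGeneric Y ∧ DemuthGeneric.Computes X Y :=
  DemuthGeneric.exists_oneGeneric_computes hX
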